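/- Let $\mathbb{K}$ be a field of characteristic zero and let $A$ be a commutative $\mathbb{K}$-algebra that is either finitely generated over $\mathbb{K}$ or a complete local ring. Let $D_{A|\mathbb{K}}$ be the ring of $\mathbb{K}$-linear differential operators on $A$ (in the sense of Grothendieck); each of its elements extends uniquely to a differential operator on any localization of $A$. For $f_1,\dots,f_\ell\in A$ let $M^A[\boldsymbol{f}^{\boldsymbol{s}}]=A_{f_1\cdots f_\ell}[s_1,\dots,s_\ell]\,\boldsymbol{f}^{\boldsymbol{s}}$ be the free rank-one $A_{f_1\cdots f_\ell}[s_1,\dots,s_\ell]$-module on a formal symbol $\boldsymbol{f}^{\boldsymbol{s}}=\boldsymbol{f_1^{s_1}}\cdots\boldsymbol{f_\ell^{s_\ell}}$. For $t\in\mathbb{Z}^\ell$ let $\varphi_t\colon M^A[\boldsymbol{f}^{\boldsymbol{s}}]\to A_{f_1\cdots f_\ell}$ be the map $p(s)\boldsymbol{f}^{\boldsymbol{s}}\mapsto p(t)f_1^{t_1}\cdots f_\ell^{t_\ell}$. Equip $M^A[\boldsymbol{f}^{\boldsymbol{s}}]$ with the unique $D_{A|\mathbb{K}}[s_1,\dots,s_\ell]$-module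 structure such that $\varphi_t(\delta\bullet v)=\delta(t)\bullet\varphi_t(v)$ for all $\delta$, $v$ and $t\in\mathbb{Z}^\ell$. (1) Let $f\in A$, $\delta\in D_{A|\mathbb{K}}[s]$ and $b\in\mathbb{K}[s]$. Then $\delta\bullet f\boldsymbol{f^s}=b(s)\boldsymbol{f^s}$ holds in $M^A[\boldsymbol{f^s}]$ if and only if $\delta(t)\bullet f^{t+1}=b(t)f^t$ holds in $A_f$ for all $t\in\mathbb{Z}$. (2) Let $f\in A$. The formal (respectively, specialized) Bernstein–Sato polynomial of $f$ is the monic polynomial of smallest degree among the nonzero $b\in\mathbb{K}[s]$ for which some $\delta\in D_{A|\mathbb{K}}[s]$ satisfies the first (respectively, the second) condition in (1). The formal one exists if and only if the specialized one exists, and in this case they are equal. (3) Let $f_1,\dots,f_\ell\in A$, let $b\in\mathbb{K}[s]$, and let $(\delta_c)$ be a family of elements of $D_{A|\mathbb{K}}[s_1,\dots,s_\ell]$, indexed by the $c\in\mathbb{Z}^\ell$ with $c_1+\cdots+c_\ell=1$, all but finitely many of which are zero. Then $$\sum_c\delta_c\bullet\prod_{i:\,c_i<0}\binom{s_i}{-c_i}\,f_1^{c_1}\cdots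 f_\ell^{c_\ell}\,\boldsymbol{f}^{\boldsymbol{s}}=b(s_1+\cdots+s_\ell)\,\boldsymbol{f}^{\boldsymbol{s}}$$ holds in $M^A[\boldsymbol{f}^{\boldsymbol{s}}]$ if and only if $$\sum_c\delta_c(t)\bullet\prod_{i:\,c_i<0}\binom{t_i}{-c_i}\,f_1^{t_1+c_1}\cdots f_\ell^{t_\ell+c_\ell}=b(t_1+\cdots+t_\ell)\,f_1^{t_1}\cdots f_\ell^{t_\ell}$$ holds in $A_{f_1\cdots f_\ell}$ for all $t\in\mathbb{Z}^\ell$. (4) Let $f_1,\dots,f_\ell\in A$. The formal (respectively, specialized) Bernstein–Sato polynomial of $f_1,\dots,f_\ell$ is the monic polynomial of smallest degree among the nonzero $b\in\mathbb{K}[s]$ for which some family $(\delta_c)$ satisfies the first (respectively, the second) condition in (3). The formal one exists if and only if the specialized one exists, and in this case they are equal. -/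

import Mathlib

noncomputable section

namespace BernsteinSato

/-! ### Rings of differential operators -/

/-- `K`-linear differential operators of order at most `n` on a commutative `K`-algebra `T`. -/
def IsDiffOp (K : Type*) {T : Type*} [Field K] [CommRing T] [Algebra K T] :
    ℕ → Module.End K T → Prop
  | 0, δ => ∃ a : T, δ = LinearMap.mulLeft K a
  | n + 1, δ => ∀ a : T,
      IsDiffOp K n (δ * LinearMap.mulLeft K a - LinearMap.mulLeft K a * δ)

/-- Auxiliary, for maps `P → Q` between `A`-modules: all `n`-fold commutators with elements of `A`
vanish (so for `P = Q = A` this says that the order is at most `n - 1`). -/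
def CommNil (K : Type*) (A : Type*) {P Q : Type*} [Field K] [CommRing A] [Algebra K A]
    [AddCommGroup P] [Module K P] [Module A P] [IsScalarTower K A P]
    [AddCommGroup Q] [Module K Q] [Module A Q] [IsScalarTower K A Q] :
    ℕ → (P →ₗ[K] Q) → Prop
  | 0, δ => δ = 0
  | n + 1, δ => ∀ a : A,
      CommNil K A n (δ ∘ₗ Algebra.lsmul K K P a - Algebra.lsmul K K Q a ∘ₗ δ)

section CommNil

variable {K : Type*} {A : Type*} {P Q N : Type*} [Field K] [CommRing A] [Algebra K A]
    [AddCommGroup P] [Module K P] [Module A P] [IsScalarTower K A P]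
    [AddCommGroup Q] [Module K Q] [Module A Q] [IsScalarTower K A Q]
    [AddCommGroup N] [Module K N] [Module A N] [IsScalarTower K A N]

theorem CommNil.zero (n : ℕ) : CommNil K A n (0 : P →ₗ[K] Q) := by
  induction n with
  | zero => rfl
  | succ n ih => intro a; simpa using ih

theorem CommNil.add {n : ℕ} {δ ε : P →ₗ[K] Q} (hδ : CommNil K A n δ) (hε : CommNil K A n ε) :
    CommNil K A n (δ + ε) := by
  induction n generalizing δ ε with
  | zero => have h1 : δ = 0 := hδ; have h2 : ε = 0 := hε; simp [CommNil, h1, h2]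
  | succ n ih =>
    intro a
    have := ih (hδ a) (hε a)
    convert this using 1
    ext x; simp; abel

theorem CommNil.succ {n : ℕ} {δ : P →ₗ[K] Q} (hδ : CommNil K A n δ) :
    CommNil K A (n + 1) δ := by
  induction n generalizing δ with
  | zero => have h1 : δ = 0 := hδ; subst h1; exact CommNil.zero 1
  | succ n ih => intro a; exact ih (hδ a)

theorem CommNil.mono {m n : ℕ} (h : m ≤ n) {δ : P →ₗ[K] Q} (hδ : CommNil K A m δ) :
    CommNil K A n δ := by
  induction h with
  | refl => exact hδ
  | step _ ih => exact ih.succ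

theorem CommNil.comp {m n : ℕ} {δ : Q →ₗ[K] N} {ε : P →ₗ[K] Q} (hδ : CommNil K A m δ)
    (hε : CommNil K A n ε) : CommNil K A (m + n) (δ ∘ₗ ε) := by
  induction h : m + n generalizing m n δ ε with
  | zero =>
    obtain ⟨rfl, rfl⟩ : m = 0 ∧ n = 0 := by omega
    have h1 : δ = 0 := hδ
    simp [CommNil, h1]
  | succ k ih =>
    rcases m with _ | m
    · have h1 : δ = 0 := hδ
      subst h1; simpa using CommNil.zero (k + 1)
    rcases n with _ | n
    · have h1 : ε = 0 := hε
      subst h1; simpa using CommNil.zero (k + 1)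
    intro a
    have e1 := ih (hδ a) hε (by omega)
    have e2 := ih hδ (hε a) (by omega)
    convert e1.add e2 using 1
    ext x; simp

end CommNil

theorem isDiffOp_iff {K T : Type*} [Field K] [CommRing T] [Algebra K T] (n : ℕ)
    (δ : Module.End K T) : IsDiffOp K n δ ↔ CommNil K T (n + 1) δ := by
  induction n generalizing δ with
  | zero =>
    constructor
    · rintro ⟨a, rfl⟩ b
      change _ = _
      ext x; simp; ring
    · intro h
      refine ⟨δ 1, ?_⟩
      ext x
      have h0 : δ ∘ₗ (Algebra.lsmul K K T) x - (Algebra.lsmul K K T) x ∘ₗ δ = 0 := h x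
      have := LinearMap.congr_fun h0 1
      simp [sub_eq_zero] at this
      simp [this, mul_comm]
  | succ n ih => exact forall_congr' fun a => ih _

/-- The ring `D_{T|K}` of `K`-linear differential operators on `T`. -/
def DiffOp (K T : Type*) [Field K] [CommRing T] [Algebra K T] :
    Subalgebra K (Module.End K T) where
  carrier := {δ | ∃ n, IsDiffOp K n δ}
  mul_mem' := by
    rintro δ ε ⟨m, hm⟩ ⟨n, hn⟩
    rw [isDiffOp_iff] at hm hn
    exact ⟨m + 1 + n, (isDiffOp_iff _ _).2 (hm.comp hn)⟩
  add_mem' := by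
    rintro δ ε ⟨m, hm⟩ ⟨n, hn⟩
    rw [isDiffOp_iff] at hm hn
    exact ⟨m + n, (isDiffOp_iff _ _).2
      ((hm.mono (by omega)).add (hn.mono (by omega)))⟩
  algebraMap_mem' := fun r => ⟨0, algebraMap K T r, by
    ext x; simp [Algebra.smul_def]⟩

theorem mem_diffOp {K T : Type*} [Field K] [CommRing T] [Algebra K T]
    {δ : Module.End K T} : δ ∈ DiffOp K T ↔ ∃ n, CommNil K T n δ := by
  constructor
  · rintro ⟨n, hn⟩; exact ⟨n + 1, (isDiffOp_iff _ _).1 hn⟩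
  · rintro ⟨n, hn⟩; exact ⟨n, (isDiffOp_iff _ _).2 hn.succ⟩

/-! ### Extension of differential operators to localizations -/

section Localization

variable {K A B : Type*} [Field K] [CommRing A] [Algebra K A] [CommRing B] [Algebra K B]
  [Algebra A B] [IsScalarTower K A B] 

theorem CommNil.eq_zero_of_comp (S : Submonoid A) [IsLocalization S B] {n : ℕ} {δ : B →ₗ[K] B} (hδ : CommNil K A n δ)
    (h : ∀ a : A, δ (algebraMap A B a) = 0) : δ = 0 := by
  induction n generalizing δ with
  | zero => exact hδ
  | succ n ih =>
    ext x
    obtain ⟨a, u, rfl⟩ := IsLocalization.exists_mk'_eq S x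
    have h0 := ih (hδ u) (fun b => by simp [Algebra.smul_def, ← map_mul, h])
    have h1 := LinearMap.congr_fun h0 (IsLocalization.mk' B a u)
    simp only [LinearMap.sub_apply, LinearMap.comp_apply, Algebra.lsmul_coe, Algebra.smul_def,
      IsLocalization.mk'_spec', h, LinearMap.zero_apply, zero_sub, neg_eq_zero] at h1
    exact (IsLocalization.map_units B u).mul_right_eq_zero.1 h1

theorem commNil_lsmul (b : B) : CommNil K A 1 (Algebra.lsmul K K B b) := by
  intro a
  change _ = _
  ext x
  simp

theorem CommNil.lsmul_comp_comp {n : ℕ} {ε : B →ₗ[K] B} (h : CommNil K A n ε) (b c : B) :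
    CommNil K A n (Algebra.lsmul K K B b ∘ₗ ε ∘ₗ Algebra.lsmul K K B c) := by
  induction n generalizing ε with
  | zero => have h : ε = 0 := h; subst h; simp [CommNil]
  | succ n ih =>
    intro x
    convert ih (h x) using 1
    ext y; simp [mul_sub]

/-- Commutators with elements of `A` and with elements of a localization of `A` give the same
differential operators. -/
theorem CommNil.of_localization (S : Submonoid A) [IsLocalization S B] {n : ℕ} {δ : B →ₗ[K] B}
    (hδ : CommNil K A n δ) : CommNil K B n δ := by
  induction n generalizing δ with
  | zero => exact hδ
  | succ n ih =>
    intro b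
    apply ih
    obtain ⟨a, u, rfl⟩ := IsLocalization.exists_mk'_eq S b
    set c : B := IsLocalization.mk' B (1 : A) u with hcdef
    have huc : algebraMap A B u * c = 1 := by simp [hcdef]
    have hmk : IsLocalization.mk' B a u = algebraMap A B a * c := by
      rw [hcdef, IsLocalization.mul_mk'_eq_mk'_of_mul, mul_one]
    have e1 := CommNil.lsmul_comp_comp (hδ a) 1 c
    have e2 := CommNil.lsmul_comp_comp (hδ u) (-algebraMap A B a * c) c
    convert e1.add e2 using 1
    ext x
    simp only [hmk, LinearMap.sub_apply, LinearMap.add_apply, LinearMap.comp_apply,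
      Algebra.lsmul_coe, Algebra.smul_def, Algebra.algebraMap_self, RingHom.id_apply]
    rw [← mul_assoc (algebraMap A B u) c x, huc, ← mul_assoc (algebraMap A B a) c x]
    simp only [one_mul]
    linear_combination (-(algebraMap A B a) * δ (c * x)) * huc

theorem CommNil.exists_ext (S : Submonoid A) [IsLocalization S B] {n : ℕ} {δ : A →ₗ[K] B}
    (hδ : CommNil K A n δ) :
    ∃ δ' : B →ₗ[K] B, CommNil K A n δ' ∧ ∀ a : A, δ' (algebraMap A B a) = δ a := by
  induction n generalizing δ with
  | zero => exact ⟨0, rfl, fun a => by have h : δ = 0 := hδ; simp [h]⟩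
  | succ n ih =>
    choose ε hε hεa using fun a => ih (hδ a)
    simp only [LinearMap.sub_apply, LinearMap.comp_apply, Algebra.lsmul_coe, Algebra.smul_def,
      Algebra.algebraMap_self, RingHom.id_apply] at hεa
    have hmul : ∀ (u v : A) (x : B),
        ε (u * v) x = ε u (algebraMap A B v * x) + algebraMap A B u * ε v x := by
      intro u v x
      have hz : CommNil K A (n + 1) (ε u ∘ₗ Algebra.lsmul K K B (algebraMap A B v) +
          Algebra.lsmul K K B (algebraMap A B u) ∘ₗ ε v +
          Algebra.lsmul K K B (-1 : B) ∘ₗ ε (u * v)) :=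
        (((hε u).comp (commNil_lsmul _)).add
          (((commNil_lsmul _).comp (hε v)).mono (by omega))).add
          (((commNil_lsmul _).comp (hε (u * v))).mono (by omega))
      have := LinearMap.congr_fun (hz.eq_zero_of_comp S (fun a => by
        have e1 := hεa u (v * a)
        have e2 := hεa v a
        have e3 := hεa (u * v) a
        rw [map_mul] at e1
        rw [map_mul (algebraMap A B) u v, mul_assoc u v a] at e3
        simp only [LinearMap.add_apply, LinearMap.comp_apply, Algebra.lsmul_coe, smul_eq_mul]
        linear_combination e1 + algebraMap A B u * e2 - e3)) x
      simp only [LinearMap.add_apply, LinearMap.comp_apply, Algebra.lsmul_coe, smul_eq_mul,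
          LinearMap.zero_apply] at this
      linear_combination -this
    have hinj : ∀ y y' : A, algebraMap A B y = algebraMap A B y' → δ y = δ y' := by
      intro y y' h
      obtain ⟨c, hc⟩ := (IsLocalization.eq_iff_exists S B).1 h
      have h1 := hεa c y
      have h2 := hεa c y'
      rw [h, h2, hc] at h1
      exact (IsLocalization.map_units B c).mul_left_cancel (by linear_combination h1)
    have hwd : ∀ (x : B) (a u a' u' : A), algebraMap A B u * x = algebraMap A B a →
        algebraMap A B u' * x = algebraMap A B a' →
        algebraMap A B u' * (δ a - ε u x) = algebraMap A B u * (δ a' - ε u' x) := by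
      intro x a u a' u' h h'
      have h1 := hεa u' a
      have h2 := hεa u a'
      have h3 := hmul u' u x
      have h4 := hmul u u' x
      rw [h] at h3
      rw [h'] at h4
      have h5 : δ (u' * a) = δ (u * a') := hinj _ _ (by
        rw [map_mul, map_mul, ← h, ← h']; ring)
      rw [mul_comm u' u] at h3
      linear_combination h1 - h2 - h4 + h3 + h5
    have hex : ∀ x : B, ∃ y : B, ∀ a u : A, u ∈ S → algebraMap A B u * x = algebraMap A B a →
        algebraMap A B u * y = δ a - ε u x := by
      intro x
      obtain ⟨a, u, rfl⟩ := IsLocalization.exists_mk'_eq S x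
      obtain ⟨w, hw⟩ := (IsLocalization.map_units B u).exists_right_inv
      refine ⟨w * (δ a - ε u (IsLocalization.mk' B a u)), fun a' u' _ h' => ?_⟩
      have := hwd _ a u a' u' (IsLocalization.mk'_spec' B a u) h'
      linear_combination w * this + (δ a' - ε u' (IsLocalization.mk' B a u)) * hw
    choose T hT using hex
    have hrep : ∀ x : B, ∃ a u : A, u ∈ S ∧ algebraMap A B u * x = algebraMap A B a := by
      intro x
      obtain ⟨a, u, rfl⟩ := IsLocalization.exists_mk'_eq S x
      exact ⟨a, u, u.2, IsLocalization.mk'_spec' B a u⟩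
    have hcancel : ∀ u ∈ S, ∀ y y' : B, algebraMap A B u * y = algebraMap A B u * y' → y = y' :=
      fun u hu y y' h => (IsLocalization.map_units B (⟨u, hu⟩ : S)).mul_left_cancel h
    let T' : B →ₗ[K] B :=
      { toFun := T
        map_add' := by
          intro x y
          obtain ⟨a, u, hu, hx⟩ := hrep x
          obtain ⟨b, v, hv, hy⟩ := hrep y
          have huv := S.mul_mem hu hv
          apply hcancel (u * v) huv
          have hx' : algebraMap A B (u * v) * x = algebraMap A B (v * a) := by
            rw [map_mul, map_mul, ← hx]; ring
          have hy' : algebraMap A B (u * v) * y = algebraMap A B (u * b) := by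
            rw [map_mul, map_mul, ← hy]; ring
          rw [mul_add, hT x _ _ huv hx', hT y _ _ huv hy', hT (x + y) (v * a + u * b) _ huv
            (by rw [mul_add, hx', hy', map_add]), map_add, map_add]
          ring
        map_smul' := by
          intro r x
          obtain ⟨a, u, hu, hx⟩ := hrep x
          apply hcancel u hu
          rw [RingHom.id_apply, mul_smul_comm, hT x _ _ hu hx, hT (r • x) (r • a) _ hu
            (by rw [mul_smul_comm, hx]; simp [Algebra.smul_def, ← IsScalarTower.algebraMap_apply]), map_smul, map_smul, smul_sub] }
    refine ⟨T', fun c => ?_, fun a => ?_⟩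
    · convert hε c using 1
      ext x
      change T (c • x) - c • T x = ε c x
      obtain ⟨a, u, hu, hx⟩ := hrep x
      apply hcancel u hu
      have h1 := hT x _ _ hu hx
      have h2 := hT (c • x) (c * a) _ hu (by
        rw [map_mul, ← hx, Algebra.smul_def]; ring)
      have h3 := hmul c u x
      have h4 := hmul u c x
      have h5 := hεa c a
      rw [hx] at h3
      rw [mul_comm c u] at h3
      simp only [Algebra.smul_def] at h2 ⊢
      linear_combination h2 - algebraMap A B c * h1 - h5 - h3 + h4
    · change T (algebraMap A B a) = δ a
      have h1 := hT (algebraMap A B a) a 1 S.one_mem (by simp)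
      have h2 := hεa 1 a
      simpa [h2] using h1

/-- A differential operator on `A` extends uniquely to a differential operator on any localization
of `A`. -/
theorem existsUnique_ext (S : Submonoid A) [IsLocalization S B] (δ : DiffOp K A) :
    ∃! δ' : DiffOp K B, ∀ a : A,
      (δ' : Module.End K B) (algebraMap A B a) = algebraMap A B ((δ : Module.End K A) a) := by
  have restr : ∀ (n : ℕ) (ε : Module.End K B), CommNil K B n ε → CommNil K A n ε := by
    intro n
    induction n with
    | zero => exact fun _ h => h
    | succ n ih =>
      intro ε h a
      convert ih _ (h (algebraMap A B a)) using 1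
      ext x; simp [Algebra.smul_def]
  obtain ⟨n, hn⟩ := mem_diffOp.1 δ.2
  have hι : CommNil K A 1 (IsScalarTower.toAlgHom K A B).toLinearMap := by
    intro a
    change _ = _
    ext x; simp [Algebra.smul_def]
  obtain ⟨δ', h1, h2⟩ := (hι.comp hn).exists_ext S
  refine ⟨⟨δ', mem_diffOp.2 ⟨_, h1.of_localization S⟩⟩, h2, ?_⟩
  rintro ⟨ε, hε⟩ h
  obtain ⟨m, hm⟩ := mem_diffOp.1 hε
  have hm := restr _ _ hm
  have hz : CommNil K A (m + (1 + n) + 1) (ε + Algebra.lsmul K K B (-1 : B) ∘ₗ δ') :=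
    (hm.mono (by omega)).add (((commNil_lsmul _).comp h1).mono (by omega))
  have := hz.eq_zero_of_comp S (fun a => by
    have e1 := h a
    have e2 := h2 a
    simp at e1 e2 ⊢
    rw [e1, e2]; ring)
  ext x
  have := LinearMap.congr_fun this x
  simp at this
  linear_combination this

end Localization

/-- The localization `A_{f_1 ⋯ f_ℓ}`. -/
abbrev Loc {A ι : Type*} [CommRing A] [Fintype ι] (f : ι → A) : Type _ :=
  Localization.Away (∏ i, f i)

/-- The unique extension of a differential operator on `A` to `A_{f_1 ⋯ f_ℓ}`. -/
def extend {K A ι : Type*} [Field K] [CommRing A] [Algebra K A] [Fintype ι] (f : ι → A)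
    (δ : DiffOp K A) : DiffOp K (Loc f) :=
  (existsUnique_ext (B := Loc f) (Submonoid.powers (∏ i, f i)) δ).choose

/-- The action `δ • x` of `D_{A|K}` on `A_{f_1 ⋯ f_ℓ}`. -/
def locAct {K A ι : Type*} [Field K] [CommRing A] [Algebra K A] [Fintype ι] (f : ι → A)
    (δ : DiffOp K A) (x : Loc f) : Loc f :=
  (extend f δ : Module.End K (Loc f)) x

/-- The element `f_i` as a unit of `A_{f_1 ⋯ f_ℓ}`. -/
def locUnit {A ι : Type*} [CommRing A] [Fintype ι] (f : ι → A) (i : ι) : (Loc f)ˣ :=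
  (isUnit_of_dvd_unit (map_dvd (algebraMap A (Loc f)) (Finset.dvd_prod_of_mem f (Finset.mem_univ i)))
    (IsLocalization.Away.algebraMap_isUnit (∏ i, f i))).unit

/-- The Laurent monomial `f_1 ^ t_1 ⋯ f_ℓ ^ t_ℓ` in `A_{f_1 ⋯ f_ℓ}`. -/
def fpow {A ι : Type*} [CommRing A] [Fintype ι] (f : ι → A) (t : ι → ℤ) : (Loc f)ˣ :=
  ∏ i, locUnit f i ^ t i

theorem extend_algebraMap {K A ι : Type*} [Field K] [CommRing A] [Algebra K A] [Fintype ι]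
    (f : ι → A) (δ : DiffOp K A) (a : A) :
    (extend f δ : Module.End K (Loc f)) (algebraMap A (Loc f) a) =
      algebraMap A (Loc f) ((δ : Module.End K A) a) :=
  (existsUnique_ext (B := Loc f) (Submonoid.powers (∏ i, f i)) δ).choose_spec.1 a

theorem extend_unique {K A ι : Type*} [Field K] [CommRing A] [Algebra K A] [Fintype ι]
    (f : ι → A) (δ : DiffOp K A) (ε : DiffOp K (Loc f))
    (h : ∀ a : A, (ε : Module.End K (Loc f)) (algebraMap A (Loc f) a) =
      algebraMap A (Loc f) ((δ : Module.End K A) a)) : extend f δ = ε :=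
  ((existsUnique_ext (B := Loc f) (Submonoid.powers (∏ i, f i)) δ).choose_spec.2 ε h).symm

/-! ### Conjugation of differential operators by powers of units -/

/-- The binomial coefficient `s_i (s_i - 1) ⋯ (s_i - m + 1) / m!` as a polynomial. -/
def binomPoly (K : Type*) {B ι : Type*} [Field K] [CommRing B] [Algebra K B] (i : ι) (m : ℕ) :
    MvPolynomial ι B :=
  MvPolynomial.C (algebraMap K B ((m.factorial : K)⁻¹)) *
    ∏ k ∈ Finset.range m, (MvPolynomial.X i - MvPolynomial.C (k : B))

section Conj

variable {K B ι : Type*} [Field K] [CommRing B] [Algebra K B]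

theorem eval_binomPoly [CharZero K] (t : ι → ℤ) (i : ι) (m : ℕ) :
    MvPolynomial.eval (fun i => (t i : B)) (binomPoly K i m) = ((Ring.choose (t i) m : ℤ) : B) := by
  have h1 := Ring.descPochhammer_eq_factorial_smul_choose (t i) m
  have h2 : ((m.factorial : ℤ) * Ring.choose (t i) m) =
      ∏ k ∈ Finset.range m, (t i - (k : ℤ)) := by
    rw [← nsmul_eq_mul, ← h1, ← Polynomial.eval_eq_smeval, descPochhammer_eval_eq_prod_range]
  have h3 : (algebraMap K B ((m.factorial : K)⁻¹)) * (m.factorial : B) = 1 := by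
    rw [← map_natCast (algebraMap K B), ← map_mul, inv_mul_cancel₀
      (Nat.cast_ne_zero.2 m.factorial_ne_zero), map_one]
  have h4 := congrArg (Int.cast : ℤ → B) h2
  push_cast at h4
  simp only [binomPoly, map_mul, MvPolynomial.eval_C, map_prod, map_sub, MvPolynomial.eval_X]
  rw [← h4, ← mul_assoc, h3, one_mul]

/-- The commutator `[D, u]`. -/
def ad (K : Type*) {B : Type*} [Field K] [CommRing B] [Algebra K B] (u : B) (D : B →ₗ[K] B) :
    B →ₗ[K] B :=
  D ∘ₗ Algebra.lsmul K K B u - Algebra.lsmul K K B u ∘ₗ D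

theorem CommNil.ad {n : ℕ} {D : B →ₗ[K] B} (h : CommNil K B n D) (u : B) :
    CommNil K B n (ad K u D) := by
  rcases n with _ | n
  · have h : D = 0 := h
    subst h; simp [CommNil, BernsteinSato.ad]
  · exact (h u).succ

theorem CommNil.ad_iterate {n : ℕ} {D : B →ₗ[K] B} (h : CommNil K B n D) (u : B) (j : ℕ) :
    CommNil K B n ((BernsteinSato.ad K u)^[j] D) := by
  induction j with
  | zero => exact h
  | succ j ih => rw [Function.iterate_succ_apply']; exact ih.ad u

theorem conj_zpow (u : Bˣ) (n : ℕ) (D : B →ₗ[K] B) (hD : CommNil K B n D) (h : B) (t : ℤ) :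
    ((u ^ t)⁻¹ : Bˣ) * D ((u ^ t : Bˣ) * h) =
      ∑ j ∈ Finset.range n, ((Ring.choose t j : ℤ) : B) *
        (((u⁻¹ ^ j : Bˣ) : B) * ((ad K (u : B))^[j] D) h) := by
  induction n generalizing D t with
  | zero => have hD : D = 0 := hD; simp [hD]
  | succ n ih =>
    have key : ∀ t : ℤ, ((u ^ (t + 1))⁻¹ : Bˣ) * D ((u ^ (t + 1) : Bˣ) * h) -
        ((u ^ t)⁻¹ : Bˣ) * D ((u ^ t : Bˣ) * h) =
        ∑ j ∈ Finset.range (n + 1), ((Ring.choose (t + 1) j : ℤ) : B) *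
          (((u⁻¹ ^ j : Bˣ) : B) * ((ad K (u : B))^[j] D) h) -
        ∑ j ∈ Finset.range (n + 1), ((Ring.choose t j : ℤ) : B) *
          (((u⁻¹ ^ j : Bˣ) : B) * ((ad K (u : B))^[j] D) h) := by
      intro t
      have h1 := ih (ad K (u : B) D) (hD u) t
      have h2 : ((u ^ (t + 1))⁻¹ : Bˣ) * D ((u ^ (t + 1) : Bˣ) * h) -
        ((u ^ t)⁻¹ : Bˣ) * D ((u ^ t : Bˣ) * h) = ((u⁻¹ : Bˣ) : B) *
          (((u ^ t)⁻¹ : Bˣ) * (ad K (u : B) D) ((u ^ t : Bˣ) * h)) := by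
        have e : (((u ^ (t + 1))⁻¹ : Bˣ) : B) = ((u⁻¹ : Bˣ) : B) * ((u ^ t)⁻¹ : Bˣ) := by
          rw [← Units.val_mul, zpow_add_one, mul_inv, mul_comm]
        have e' : ((u ^ (t + 1) : Bˣ) : B) * h = (u : B) * ((u ^ t : Bˣ) * h) := by
          rw [zpow_add_one, Units.val_mul]; ring
        rw [e, e']
        simp only [BernsteinSato.ad, LinearMap.sub_apply, LinearMap.comp_apply, Algebra.lsmul_coe,
          smul_eq_mul]
        linear_combination -(((u ^ t)⁻¹ : Bˣ) * D ((u ^ t : Bˣ) * h)) * (-u.inv_mul)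
      rw [h2, h1, ← Finset.sum_sub_distrib, Finset.sum_range_succ', Finset.mul_sum]
      simp only [Ring.choose_zero_right, sub_self, add_zero]
      refine Finset.sum_congr rfl fun j _ => ?_
      rw [Ring.choose_succ_succ, Function.iterate_succ_apply, pow_succ, Units.val_mul]
      push_cast
      ring
    induction t using Int.induction_on with
    | zero =>
      rw [Finset.sum_range_succ']
      simp [Ring.choose_zero_succ]
    | succ t iht =>
      have := key t
      linear_combination this + iht
    | pred t iht =>
      have := key (-t - 1)
      rw [sub_add_cancel] at this
      linear_combination iht - this

/-- For a differential operator `D`, the expression `f^{-t} D (f^t h)` is a polynomial in `t`. -/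
theorem exists_conj_poly [CharZero K] (u : ι → Bˣ) (s : Finset ι) (n : ℕ) (D : B →ₗ[K] B)
    (hD : CommNil K B n D) (h : B) :
    ∃ p : MvPolynomial ι B, ∀ t : ι → ℤ, MvPolynomial.eval (fun i => (t i : B)) p =
      ((∏ i ∈ s, u i ^ t i)⁻¹ : Bˣ) * D ((∏ i ∈ s, u i ^ t i : Bˣ) * h) := by
  classical
  induction s using Finset.induction_on generalizing D with
  | empty => exact ⟨MvPolynomial.C (D h), fun t => by simp⟩
  | insert i s hi ih =>
    choose p hp using fun j => ih ((ad K (u i : B))^[j] D) (hD.ad_iterate _ j)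
    refine ⟨∑ j ∈ Finset.range n, binomPoly K i j *
      (MvPolynomial.C (((u i)⁻¹ ^ j : Bˣ) : B) * p j), fun t => ?_⟩
    have h1 := conj_zpow (u i) n D hD ((∏ i ∈ s, u i ^ t i : Bˣ) * h) (t i)
    rw [Finset.prod_insert hi, mul_inv, Units.val_mul, Units.val_mul, mul_assoc, mul_assoc,
      mul_left_comm, h1, Finset.mul_sum, map_sum]
    refine Finset.sum_congr rfl fun j _ => ?_
    rw [map_mul, map_mul, eval_binomPoly, MvPolynomial.eval_C, hp]
    ring

end Conj

/-- A polynomial over an algebra of characteristic zero that vanishes at all tuples of integers is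
zero. -/
theorem eq_zero_of_eval_int {B ι : Type*} [CommRing B] (K : Type*) [Field K] [CharZero K] [Algebra K B] (p : MvPolynomial ι B)
    (h : ∀ t : ι → ℤ, MvPolynomial.eval (fun i => (t i : B)) p = 0) : p = 0 := by
  ext m
  rw [MvPolynomial.coeff_zero, ← Module.forall_dual_apply_eq_zero_iff K]
  intro φ
  set q : MvPolynomial ι K := ∑ m ∈ p.support, MvPolynomial.monomial m (φ (p.coeff m)) with hq
  have hq0 : q = 0 := by
    apply MvPolynomial.funext_set (fun _ => Set.range (Int.cast : ℤ → K))
      (fun _ => Set.infinite_range_of_injective Int.cast_injective)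
    intro x hx
    choose t ht using fun i => hx i (Set.mem_univ i)
    obtain rfl : x = fun i => (t i : K) := funext fun i => (ht i).symm
    have := congrArg φ (h t)
    rw [MvPolynomial.eval_eq, map_sum, map_zero] at this
    rw [hq, map_sum, map_zero, ← this]
    refine Finset.sum_congr rfl fun m _ => ?_
    rw [MvPolynomial.eval_monomial, Finsupp.prod]
    have e : (∏ i ∈ m.support, (t i : B) ^ m i) = algebraMap K B (∏ i ∈ m.support, (t i : K) ^ m i) := by
      simp
    rw [e, mul_comm, ← Algebra.commutes, ← Algebra.smul_def, map_smul, smul_eq_mul, mul_comm]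
  have := congrArg (MvPolynomial.coeff m) hq0
  rw [hq, MvPolynomial.coeff_sum] at this
  classical
  simp only [MvPolynomial.coeff_monomial, Finset.sum_ite_eq', MvPolynomial.coeff_zero] at this
  split_ifs at this with hm
  · exact this
  · rw [MvPolynomial.notMem_support_iff.1 hm, map_zero]

/-! ### The module `M^A[f^s]` -/

/-- The polynomial ring `D_{A|K}[s_i : i ∈ ι]` in central variables `s_i`. -/
abbrev DiffOpPoly (K A ι : Type*) [Field K] [CommRing A] [Algebra K A] : Type _ :=
  AddMonoidAlgebra (DiffOp K A) (ι →₀ ℕ)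

instance {K A ι : Type*} [Field K] [CommRing A] [Algebra K A] : Ring (DiffOpPoly K A ι) :=
  inferInstanceAs (Ring (@AddMonoidAlgebra (DiffOp K A) (ι →₀ ℕ) Ring.toSemiring))

/-- The specialization `δ(s) ↦ δ(t)` from `D_{A|K}[s]` to `D_{A|K}` at a tuple `t` of integers. -/
def specialize {K A ι : Type*} [Field K] [CommRing A] [Algebra K A] [Fintype ι] (t : ι → ℤ) :
    DiffOpPoly K A ι →+* DiffOp K A :=
  AddMonoidAlgebra.liftNCRingHom (RingHom.id (DiffOp K A))
    { toFun := fun m => ((∏ i, t i ^ m.toAdd i : ℤ) : DiffOp K A)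
      map_one' := by simp
      map_mul' := fun m n => by
        rw [← Int.cast_mul, ← Finset.prod_mul_distrib]
        simp [pow_add] }
    (fun x y => (Int.cast_commute (∏ i, t i ^ y.toAdd i) x).symm)

/-- The free rank-one `A_{f_1 ⋯ f_ℓ}[s_1, …, s_ℓ]`-module `M^A[f^s]`; the element `p • f^s` is
represented by its coefficient `p`. -/
def BSModule {A ι : Type*} [CommRing A] [Fintype ι] (f : ι → A) : Type _ :=
  MvPolynomial ι (Loc f)

namespace BSModule

variable {K A ι : Type*} [Field K] [CommRing A] [Algebra K A] [Fintype ι] (f : ι → A)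

instance : AddCommGroup (BSModule f) :=
  inferInstanceAs (AddCommGroup (MvPolynomial ι (Loc f)))

instance : Module (MvPolynomial ι (Loc f)) (BSModule f) :=
  inferInstanceAs (Module (MvPolynomial ι (Loc f)) (MvPolynomial ι (Loc f)))

/-- The free generator `f_1^{s_1} ⋯ f_ℓ^{s_ℓ}`. -/
def gen : BSModule f := (1 : MvPolynomial ι (Loc f))

/-- The coefficient of the generator. -/
def coeff (v : BSModule f) : MvPolynomial ι (Loc f) := v

/-- The exponent specialization map `φ_t`, sending `p(s) f^s` to `p(t) f^t`. -/
def spec (t : ι → ℤ) : BSModule f →+ Loc f :=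
  (AddMonoidHom.mulRight (fpow f t : Loc f)).comp
    (MvPolynomial.eval (fun i => (t i : Loc f)) : MvPolynomial ι (Loc f) →+* Loc f).toAddMonoidHom

theorem spec_smul_gen (t : ι → ℤ) (p : MvPolynomial ι (Loc f)) :
    spec f t (p • gen f) = MvPolynomial.eval (fun i => (t i : Loc f)) p * fpow f t := by
  change MvPolynomial.eval _ (p * 1) * _ = _
  rw [mul_one]

/-! ### The `D_{A|K}[s]`-module structure on `M^A[f^s]` -/

variable {f}

theorem ext_spec (K : Type*) [Field K] [CharZero K] [Algebra K A] {v w : BSModule f}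
    (h : ∀ t : ι → ℤ, spec f t v = spec f t w) : v = w := by
  have : coeff f v - coeff f w = 0 := by
    refine eq_zero_of_eval_int K _ fun t => ?_
    have h1 : MvPolynomial.eval (fun i => (t i : Loc f)) (coeff f v) * fpow f t =
      MvPolynomial.eval (fun i => (t i : Loc f)) (coeff f w) * fpow f t := h t
    rw [map_sub, (fpow f t).mul_left_inj.1 h1, sub_self]
  exact sub_eq_zero.1 this

theorem locAct_add (δ ε : DiffOp K A) (x : Loc f) :
    locAct f (δ + ε) x = locAct f δ x + locAct f ε x := by
  rw [locAct, extend_unique f (δ + ε) (extend f δ + extend f ε)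
    (fun a => by simp [extend_algebraMap])]
  rfl

theorem locAct_mul (δ ε : DiffOp K A) (x : Loc f) :
    locAct f (δ * ε) x = locAct f δ (locAct f ε x) := by
  rw [locAct, extend_unique f (δ * ε) (extend f δ * extend f ε)
    (fun a => by simp [extend_algebraMap])]
  rfl

theorem locAct_one (x : Loc f) : locAct f (1 : DiffOp K A) x = x := by
  rw [locAct, extend_unique f (1 : DiffOp K A) 1 (fun a => by simp)]
  rfl

theorem locAct_zero_left (x : Loc f) : locAct f (0 : DiffOp K A) x = 0 := by
  rw [locAct, extend_unique f (0 : DiffOp K A) 0 (fun a => by simp)]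
  rfl

theorem locAct_intCast (z : ℤ) (x : Loc f) : locAct f (z : DiffOp K A) x = z * x := by
  rw [locAct, extend_unique f (z : DiffOp K A) z (fun a => by simp)]
  simp

theorem locAct_map_add (δ : DiffOp K A) (x y : Loc f) :
    locAct f δ (x + y) = locAct f δ x + locAct f δ y := map_add _ _ _

theorem locAct_map_zero (δ : DiffOp K A) : locAct f δ (0 : Loc f) = 0 := map_zero _

theorem locAct_map_intCast_mul (δ : DiffOp K A) (z : ℤ) (x : Loc f) :
    locAct f δ (z * x) = z * locAct f δ x := by
  rw [← zsmul_eq_mul, ← zsmul_eq_mul]; exact map_zsmul _ _ _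

theorem exists_smul [CharZero K] (δ : DiffOpPoly K A ι) (v : BSModule f) :
    ∃ w : BSModule f, ∀ t : ι → ℤ, spec f t w = locAct f (specialize t δ) (spec f t v) := by
  induction δ using AddMonoidAlgebra.induction_linear with
  | zero => exact ⟨0, fun t => by rw [map_zero, map_zero, locAct_zero_left]⟩
  | add δ ε h1 h2 =>
    obtain ⟨w, hw⟩ := h1
    obtain ⟨w', hw'⟩ := h2
    exact ⟨w + w', fun t => by rw [map_add, map_add, locAct_add, hw, hw']⟩
  | single m d =>
    suffices H : ∀ p : MvPolynomial ι (Loc f), ∃ w : BSModule f, ∀ t : ι → ℤ, spec f t w =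
        locAct f (specialize t (AddMonoidAlgebra.single m d)) (spec f t (p • gen f)) by
      obtain ⟨w, hw⟩ := H (coeff f v)
      refine ⟨w, fun t => (hw t).trans ?_⟩
      congr 2
      exact mul_one (coeff f v)
    intro p
    induction p using MvPolynomial.induction_on' with
    | add p q h1 h2 =>
      obtain ⟨w, hw⟩ := h1
      obtain ⟨w', hw'⟩ := h2
      exact ⟨w + w', fun t => by rw [map_add, add_smul, map_add, locAct_map_add, hw, hw']⟩
    | monomial k a =>
      obtain ⟨n, hn⟩ := mem_diffOp.1 (extend f d).2
      obtain ⟨q, hq⟩ := exists_conj_poly (K := K) (locUnit f) Finset.univ n _ hn a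
      refine ⟨(MvPolynomial.monomial m 1 * (MvPolynomial.monomial k 1 * q)) • gen f, fun t => ?_⟩
      have e1 : specialize t (AddMonoidAlgebra.single m d : DiffOpPoly K A ι) =
          d * ((∏ i, t i ^ m i : ℤ) : DiffOp K A) :=
        AddMonoidAlgebra.liftNCRingHom_single _ _ _ _ _
      have e2 : ∀ (m : ι →₀ ℕ) (b : Loc f), MvPolynomial.eval (fun i => (t i : Loc f))
          (MvPolynomial.monomial m b) = b * ((∏ i, t i ^ m i : ℤ) : Loc f) := by
        intro m b
        rw [MvPolynomial.eval_monomial, Finsupp.prod_fintype _ _ (fun i => pow_zero _)]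
        push_cast; rfl
      have e3 : (((fpow f t)⁻¹ : (Loc f)ˣ) : Loc f) * (fpow f t : Loc f) = 1 := Units.inv_mul _
      rw [spec_smul_gen, spec_smul_gen, map_mul, map_mul, e1, e2, e2, e2, hq, locAct_mul,
        locAct_intCast, one_mul, one_mul]
      have e4 : a * ((∏ i, t i ^ k i : ℤ) : Loc f) * (fpow f t : Loc f) =
        ((∏ i, t i ^ k i : ℤ) : Loc f) * ((fpow f t : Loc f) * a) := by ring
      rw [e4, locAct_map_intCast_mul, locAct_map_intCast_mul]
      change _ * (_ * ((((fpow f t)⁻¹ : (Loc f)ˣ) : Loc f) * locAct f d ((fpow f t : Loc f) * a))) *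
        _ = _
      linear_combination ((∏ i, t i ^ m i : ℤ) : Loc f) * ((∏ i, t i ^ k i : ℤ) : Loc f) *
        locAct f d ((fpow f t : Loc f) * a) * e3

/-- There is a unique `D_{A|K}[s]`-module structure on `M^A[f^s]` that is compatible with
specialization: `φ_t(δ • v) = δ(t) • φ_t(v)` for all integer tuples `t`. -/
theorem existsUnique_module (K : Type*) {A ι : Type*} [Field K] [CharZero K] [CommRing A]
    [Algebra K A] [Fintype ι] (f : ι → A) :
    ∃! _i : Module (DiffOpPoly K A ι) (BSModule f),
      ∀ (δ : DiffOpPoly K A ι) (v : BSModule f) (t : ι → ℤ),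
        spec f t (δ • v) = locAct f (specialize t δ) (spec f t v) := by
  choose act hact using fun (δ : DiffOpPoly K A ι) (v : BSModule f) => exists_smul δ v
  refine ⟨
    { smul := act
      one_smul := fun v => ext_spec K fun t => (hact _ _ t).trans (by rw [map_one, locAct_one])
      mul_smul := fun δ ε v => ext_spec K fun t => (hact _ _ t).trans (by
        rw [map_mul, locAct_mul, ← hact, ← hact]; rfl)
      smul_zero := fun δ => ext_spec K fun t => (hact _ _ t).trans (by
        rw [map_zero, locAct_map_zero])
      smul_add := fun δ v w => ext_spec K fun t => (hact _ _ t).trans (by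
        rw [map_add, locAct_map_add, ← hact, ← hact, ← map_add]; rfl)
      add_smul := fun δ ε v => ext_spec K fun t => (hact _ _ t).trans (by
        rw [map_add, locAct_add, ← hact, ← hact, ← map_add]; rfl)
      zero_smul := fun v => ext_spec K fun t => (hact _ _ t).trans (by
        rw [map_zero, locAct_zero_left, map_zero]) }, fun δ v t => hact δ v t, ?_⟩
  intro i hi
  refine Module.ext' _ _ fun δ v => ext_spec K fun t => ?_
  exact (hi δ v t).trans (hact δ v t).symm

/-- The `D_{A|K}[s]`-module structure on `M^A[f^s]`: the unique one that is compatible with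
specialization. -/
instance instModuleDiffOpPoly {K A ι : Type*} [Field K] [CharZero K] [CommRing A]
    [Algebra K A] [Fintype ι] (f : ι → A) : Module (DiffOpPoly K A ι) (BSModule f) :=
  (existsUnique_module K f).choose

end BSModule

/-! ### Functional equations -/

section Equations

variable {K A : Type*} [Field K] [CharZero K] [CommRing A] [Algebra K A]

/-- `δ(s) • f f^s = b(s) f^s` in `M^A[f^s]`. -/
def FormalEq (f : A) (δ : DiffOpPoly K A (Fin 1)) (b : Polynomial K) : Prop :=
  δ • ((MvPolynomial.C (algebraMap A (Loc fun _ : Fin 1 => f) f) :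
      MvPolynomial (Fin 1) (Loc fun _ : Fin 1 => f)) • BSModule.gen fun _ : Fin 1 => f) =
    (Polynomial.aeval (MvPolynomial.X 0 : MvPolynomial (Fin 1) (Loc fun _ : Fin 1 => f)) b) •
      BSModule.gen fun _ : Fin 1 => f

/-- `δ(t) • f^{t+1} = b(t) f^t` in `A_f`, for all integers `t`. -/
def SpecializedEq (f : A) (δ : DiffOpPoly K A (Fin 1)) (b : Polynomial K) : Prop :=
  ∀ t : ℤ, locAct (fun _ : Fin 1 => f) (specialize (fun _ => t) δ)
      (locUnit (fun _ : Fin 1 => f) 0 ^ (t + 1) : (Loc fun _ : Fin 1 => f)ˣ) =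
    b.eval (t : K) • ((locUnit (fun _ : Fin 1 => f) 0 ^ t : (Loc fun _ : Fin 1 => f)ˣ) :
      Loc fun _ : Fin 1 => f)

/-- Finitely supported families `(δ_c)` in `D_{A|K}[s]`, indexed by the `c ∈ ℤ^ℓ` with
`c_1 + ⋯ + c_ℓ = 1`. -/
abbrev OpFamily (K A : Type*) [Field K] [CommRing A] [Algebra K A] (ℓ : ℕ) : Type _ :=
  {c : Fin ℓ → ℤ // ∑ i, c i = 1} →₀ DiffOpPoly K A (Fin ℓ)

/-- The functional equation
`∑_c δ_c • ∏_{i, c_i < 0} binom(s_i, -c_i) f_1^{c_1} ⋯ f_ℓ^{c_ℓ} f^s = b(s_1 + ⋯ + s_ℓ) f^s`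
in `M^A[f^s]`. -/
def FormalTupleEq {ℓ : ℕ} (f : Fin ℓ → A) (δ : OpFamily K A ℓ) (b : Polynomial K) : Prop :=
  (δ.sum fun c d => d •
    (((∏ i with c.1 i < 0, binomPoly K i (-(c.1 i)).toNat) *
      MvPolynomial.C (fpow f c.1 : Loc f)) • BSModule.gen f)) =
    (Polynomial.aeval (∑ i, MvPolynomial.X i : MvPolynomial (Fin ℓ) (Loc f)) b) • BSModule.gen f

/-- The specialized functional equations
`∑_c δ_c(t) • ∏_{i, c_i < 0} binom(t_i, -c_i) f_1^{t_1 + c_1} ⋯ f_ℓ^{t_ℓ + c_ℓ}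
  = b(t_1 + ⋯ + t_ℓ) f_1^{t_1} ⋯ f_ℓ^{t_ℓ}`
in `A_{f_1 ⋯ f_ℓ}`, for all integer tuples `t`. -/
def SpecializedTupleEq {ℓ : ℕ} (f : Fin ℓ → A) (δ : OpFamily K A ℓ) (b : Polynomial K) : Prop :=
  ∀ t : Fin ℓ → ℤ,
    (δ.sum fun c d => locAct f (specialize t d)
      ((∏ i with c.1 i < 0, ((Ring.choose (t i) (-(c.1 i)).toNat : ℤ) : Loc f)) *
        (fpow f (t + c.1) : Loc f))) =
    b.eval ((∑ i, t i : ℤ) : K) • (fpow f t : Loc f)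

/-- `b` is a monic polynomial of smallest degree among the nonzero elements of `S`. -/
def IsMinimalMonic (S : Set (Polynomial K)) (b : Polynomial K) : Prop :=
  b ∈ S ∧ b.Monic ∧ ∀ c ∈ S, c ≠ 0 → b.degree ≤ c.degree

/-- `b` is the formal Bernstein–Sato polynomial of the element `f`. -/
def IsFormalBS (f : A) (b : Polynomial K) : Prop :=
  IsMinimalMonic {b | ∃ δ, FormalEq f δ b} b

/-- `b` is the specialized Bernstein–Sato polynomial of the element `f`. -/
def IsSpecializedBS (f : A) (b : Polynomial K) : Prop :=
  IsMinimalMonic {b | ∃ δ, SpecializedEq f δ b} b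

/-- `b` is the formal Bernstein–Sato polynomial of the sequence `f_1, …, f_ℓ`. -/
def IsFormalTupleBS {ℓ : ℕ} (f : Fin ℓ → A) (b : Polynomial K) : Prop :=
  IsMinimalMonic {b | ∃ δ, FormalTupleEq f δ b} b

/-- `b` is the specialized Bernstein–Sato polynomial of the sequence `f_1, …, f_ℓ`. -/
def IsSpecializedTupleBS {ℓ : ℕ} (f : Fin ℓ → A) (b : Polynomial K) : Prop :=
  IsMinimalMonic {b | ∃ δ, SpecializedTupleEq f δ b} b

end Equations

end BernsteinSato

end

namespace BernsteinSato

namespace BSModule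

variable {K A ι : Type*} [Field K] [CharZero K] [CommRing A] [Algebra K A] [Fintype ι]

theorem spec_smul (f : ι → A) (δ : DiffOpPoly K A ι) (v : BSModule f) (t : ι → ℤ) :
    spec f t (δ • v) = locAct f (specialize t δ) (spec f t v) :=
  (existsUnique_module K f).choose_spec.1 δ v t

/-- The bridge between formal and specialized identities. The field is explicit because `v` and `w`
do not determine it; it enters only through the vanishing criterion for polynomials at integer
points. -/
theorem eq_iff_spec_eq (K : Type*) [Field K] [CharZero K] [Algebra K A] {f : ι → A}
    {v w : BSModule f} : v = w ↔ ∀ t : ι → ℤ, spec f t v = spec f t w :=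
  ⟨fun h _ => h ▸ rfl, ext_spec K⟩

end BSModule

open BSModule

/-! ### Evaluating both sides of a functional equation at integers -/

theorem fpow_add {A ι : Type*} [CommRing A] [Fintype ι] (f : ι → A) (t c : ι → ℤ) :
    fpow f (t + c) = fpow f t * fpow f c := by
  simp [fpow, zpow_add, Finset.prod_mul_distrib]

/-- Evaluation at `t` is a ring homomorphism fixing the scalars from `K`, so it commutes with
substitution into `b`. It serves the right-hand sides `b(s)` and `b(s_1 + ⋯ + s_ℓ)`, where `p` is a
variable or the sum of the variables. -/
theorem eval_aeval_intCast {K B ι : Type*} [Field K] [CommRing B] [Algebra K B] (t : ι → ℤ)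
    (p : MvPolynomial ι B) (z : ℤ) (hp : MvPolynomial.eval (fun i => (t i : B)) p = z)
    (b : Polynomial K) :
    MvPolynomial.eval (fun i => (t i : B)) (Polynomial.aeval p b) =
      algebraMap K B (b.eval (z : K)) := by
  rw [Polynomial.aeval_def, Polynomial.hom_eval₂, hp]
  have : (MvPolynomial.eval fun i => (t i : B)).comp (algebraMap K (MvPolynomial ι B)) =
      algebraMap K B := by
    ext k
    rw [RingHom.comp_apply, IsScalarTower.algebraMap_apply K B (MvPolynomial ι B),
      MvPolynomial.algebraMap_eq, MvPolynomial.eval_C]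
  -- The integer `z` is seen as the image of an element of `K`, so that `b` can be evaluated in `K`
  -- before mapping to `B`.
  rw [this, ← map_intCast (algebraMap K B), Polynomial.eval₂_at_apply]

/-! ### Uniqueness of the minimal monic polynomial -/

/-- Two minimal monic elements have the same degree, so their leading terms cancel; a nonzero
difference would lie in `S` with smaller degree. Closure under subtraction suffices, so `S` need not
be known to be an ideal. -/
theorem IsMinimalMonic.unique {K : Type*} [Field K] {S : Set (Polynomial K)}
    (hS : ∀ b ∈ S, ∀ c ∈ S, b - c ∈ S) {b c : Polynomial K} (hb : IsMinimalMonic S b)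
    (hc : IsMinimalMonic S c) : b = c := by
  by_contra hne
  have hdeg : b.degree = c.degree :=
    (hb.2.2 c hc.1 hc.2.1.ne_zero).antisymm (hc.2.2 b hb.1 hb.2.1.ne_zero)
  have hlt : (b - c).degree < b.degree :=
    Polynomial.degree_sub_lt_left hdeg hb.2.1.ne_zero (by rw [hb.2.1.leadingCoeff, hc.2.1.leadingCoeff])
  exact (hb.2.2 _ (hS b hb.1 c hc.1) (sub_ne_zero.2 hne)).not_gt hlt

section Equations

variable {K A : Type*} [Field K] [CharZero K] [CommRing A] [Algebra K A]

/-! ### Formal equations are equivalent to their specializations -/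

theorem formalEq_iff_specializedEq (f : A) (δ : DiffOpPoly K A (Fin 1)) (b : Polynomial K) :
    FormalEq f δ b ↔ SpecializedEq f δ b := by
  unfold FormalEq SpecializedEq
  -- The quantifier over `ℤ` on the specialized side becomes one over `Fin 1 → ℤ`, so that the two
  -- sides can be compared for each `t`.
  rw [eq_iff_spec_eq K, (Equiv.funUnique (Fin 1) ℤ).symm.forall_congr_left]
  refine forall_congr' fun t => ?_
  obtain ⟨s, rfl⟩ : ∃ s : ℤ, t = fun _ => s := ⟨t 0, funext fun i => by rw [Subsingleton.elim i 0]⟩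
  have hf : algebraMap A (Loc fun _ : Fin 1 => f) f =
    (locUnit (fun _ : Fin 1 => f) 0 : Loc fun _ : Fin 1 => f) := rfl
  have hpow : fpow (fun _ : Fin 1 => f) (fun _ => s) = locUnit (fun _ : Fin 1 => f) 0 ^ s := by
    simp [fpow]
  -- The factor `f` is absorbed into `f ^ s` inside the unit group, producing the exponent `s + 1`.
  rw [spec_smul, spec_smul_gen, spec_smul_gen, MvPolynomial.eval_C,
    eval_aeval_intCast _ _ s (by simp), hf, hpow, ← Units.val_mul, ← zpow_one_add, add_comm,
    ← Algebra.smul_def]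
  rfl

/-- Specialization is additive, so the finite sum over `c` is handled term by term. In each term the
binomial polynomials evaluate to integer binomial coefficients, and `f^c` combines with `f^t`. -/
theorem formalTupleEq_iff_specializedTupleEq {ℓ : ℕ} (f : Fin ℓ → A) (δ : OpFamily K A ℓ)
    (b : Polynomial K) : FormalTupleEq f δ b ↔ SpecializedTupleEq f δ b := by
  unfold FormalTupleEq SpecializedTupleEq
  rw [eq_iff_spec_eq K]
  refine forall_congr' fun t => ?_
  rw [spec_smul_gen, eval_aeval_intCast t _ (∑ i, t i) (by simp), ← Algebra.smul_def,
    Finsupp.sum, map_sum, Finsupp.sum]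
  refine Eq.congr (Finset.sum_congr rfl fun c _ => ?_) rfl
  rw [spec_smul, spec_smul_gen, map_mul, map_prod, MvPolynomial.eval_C, fpow_add, Units.val_mul,
    mul_assoc, mul_comm (fpow f t : Loc f)]
  simp only [eval_binomPoly]

/-! ### Bernstein–Sato polynomials: agreement and uniqueness -/

/-- Both sides are additive in the pair `(δ, b)`. This supplies the closure under subtraction
required by `IsMinimalMonic.unique`. -/
theorem FormalEq.sub {f : A} {δ ε : DiffOpPoly K A (Fin 1)} {b c : Polynomial K}
    (hδ : FormalEq f δ b) (hε : FormalEq f ε c) : FormalEq f (δ - ε) (b - c) := by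
  unfold FormalEq at *
  rw [sub_smul, hδ, hε, map_sub, sub_smul]

theorem FormalTupleEq.sub {ℓ : ℕ} {f : Fin ℓ → A} {δ ε : OpFamily K A ℓ} {b c : Polynomial K}
    (hδ : FormalTupleEq f δ b) (hε : FormalTupleEq f ε c) :
    FormalTupleEq f (δ - ε) (b - c) := by
  unfold FormalTupleEq at *
  rw [Finsupp.sum_sub_index fun _ _ _ => sub_smul _ _ _, hδ, hε, map_sub, sub_smul]

theorem isFormalBS_iff_isSpecializedBS (f : A) (b : Polynomial K) :
    IsFormalBS f b ↔ IsSpecializedBS f b := by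
  simp only [IsFormalBS, IsSpecializedBS, formalEq_iff_specializedEq]

theorem isFormalTupleBS_iff_isSpecializedTupleBS {ℓ : ℕ} (f : Fin ℓ → A) (b : Polynomial K) :
    IsFormalTupleBS f b ↔ IsSpecializedTupleBS f b := by
  simp only [IsFormalTupleBS, IsSpecializedTupleBS, formalTupleEq_iff_specializedTupleEq]

theorem IsFormalBS.unique {f : A} {b c : Polynomial K} (hb : IsFormalBS f b)
    (hc : IsFormalBS f c) : b = c :=
  IsMinimalMonic.unique (by rintro _ ⟨δ, hδ⟩ _ ⟨ε, hε⟩; exact ⟨δ - ε, hδ.sub hε⟩) hb hc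

theorem IsFormalTupleBS.unique {ℓ : ℕ} {f : Fin ℓ → A} {b c : Polynomial K}
    (hb : IsFormalTupleBS f b) (hc : IsFormalTupleBS f c) : b = c :=
  IsMinimalMonic.unique (by rintro _ ⟨δ, hδ⟩ _ ⟨ε, hε⟩; exact ⟨δ - ε, hδ.sub hε⟩) hb hc

end Equations

end BernsteinSato

theorem mainTheorem11 {K A : Type*} [Field K] [CharZero K] [CommRing A] [Algebra K A]
    (hA : Algebra.FiniteType K A ∨
      ∃ _ : IsLocalRing A, IsAdicComplete (IsLocalRing.maximalIdeal A) A) :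
    (∀ (f : A) (δ : BernsteinSato.DiffOpPoly K A (Fin 1)) (b : Polynomial K),
      BernsteinSato.FormalEq f δ b ↔ BernsteinSato.SpecializedEq f δ b) ∧
    (∀ f : A,
      ((∃ b : Polynomial K, BernsteinSato.IsFormalBS f b) ↔
        ∃ b : Polynomial K, BernsteinSato.IsSpecializedBS f b) ∧
      ∀ b b' : Polynomial K, BernsteinSato.IsFormalBS f b → BernsteinSato.IsSpecializedBS f b' →
        b = b') ∧
    (∀ (ℓ : ℕ) (f : Fin ℓ → A) (δ : BernsteinSato.OpFamily K A ℓ) (b : Polynomial K),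
      BernsteinSato.FormalTupleEq f δ b ↔ BernsteinSato.SpecializedTupleEq f δ b) ∧
    (∀ (ℓ : ℕ) (f : Fin ℓ → A),
      ((∃ b : Polynomial K, BernsteinSato.IsFormalTupleBS f b) ↔
        ∃ b : Polynomial K, BernsteinSato.IsSpecializedTupleBS f b) ∧
      ∀ b b' : Polynomial K, BernsteinSato.IsFormalTupleBS f b →
        BernsteinSato.IsSpecializedTupleBS f b' → b = b') := by
  -- For the equalities in the second and fourth parts, the specialized polynomial is reinterpreted
  -- as a formal one, and uniqueness is applied on the formal side.
  exact ⟨BernsteinSato.formalEq_iff_specializedEq,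
    fun f => ⟨exists_congr (BernsteinSato.isFormalBS_iff_isSpecializedBS f), fun b b' hb hb' =>
      hb.unique ((BernsteinSato.isFormalBS_iff_isSpecializedBS f b').2 hb')⟩,
    fun _ => BernsteinSato.formalTupleEq_iff_specializedTupleEq,
    fun _ f => ⟨exists_congr (BernsteinSato.isFormalTupleBS_iff_isSpecializedTupleBS f),
      fun b b' hb hb' =>
        hb.unique ((BernsteinSato.isFormalTupleBS_iff_isSpecializedTupleBS f b').2 hb')⟩⟩
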